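/- For abelian groups $A,B$, a function $f\colon A\to B$ and $n\ge 0$, let $$\mathrm{cr}_n f(a_1,\dots,a_n)=\sum_{U\subseteq\{1,\dots,n\}}(-1)^{n-|U|}f\Big(\sum_{l\in U}a_l\Big).$$ The map $f$ is called $n$-polynomial if $\mathrm{cr}_{n+1}f=0$. A polynomial law $F\colon A\to B$ is a family of maps of sets $F_R\colon A\otimes_{\mathbb Z}R\to B\otimes_{\mathbb Z}R$, one for every commutative ring $R$, natural with respect to unital ring homomorphisms $R\to R'$; it is $i$-homogeneous if $F_R(x\cdot r)=F_R(x)\cdot r^i$ for all $R$, all $x\in A\otimes_{\mathbb Z} R$ and all $r\in R$, and it has degree at most $n$ if $F=F_0+\dots+F_n$ with $F_i$ an $i$-homogeneous polynomial law. It extends a function $g\colon A\to B$ if $F_{\mathbb Z}=g$. If $A$ and $B$ are commutative rings, $F$ is multiplicative if every $F_R$ preserves products (but not necessarily $1$). Write $B_{(p)}$ for the localisation of $B$ at the prime $p$, that is, at the integers not divisible by $p$. Proposition. Let $n\ge 0$ be an integer and let $p>n$ be a prime. 1. Let $A$ and $B$ be abelian groups and let $f\colon A\to B$ be an $n$-polynomial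 map. Then there is exactly one polynomial law of degree at most $n$ from $A$ to $B_{(p)}$ that extends the composite $A\xrightarrow{f}B\to B_{(p)}$. 2. If moreover $A$ and $B$ are (unital) commutative rings and $f(aa')=f(a)f(a')$ for all $a,a'\in A$, then this polynomial law $A\to B_{(p)}$ is multiplicative. -/

import Mathlib

universe u v w

section PolynomialMaps

/-- The `n`-th cross-effect (or deviation) of a function `f : A → B` of abelian groups:
`cr_n f (a_1, …, a_n) = ∑_{U ⊆ {1, …, n}} (-1)^(n - |U|) f (∑_{l ∈ U} a_l)`. -/
def crossEffect {A B : Type*} [AddCommGroup A] [AddCommGroup B]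
    (n : ℕ) (f : A → B) (a : Fin n → A) : B :=
  ∑ U : Finset (Fin n), (-1 : ℤ) ^ (n - U.card) • f (∑ l ∈ U, a l)

/-- `f : A → B` is `n`-polynomial (polynomial of degree `≤ n`) if `cr_{n+1} f = 0`. -/
def IsPolynomialMap {A B : Type*} [AddCommGroup A] [AddCommGroup B]
    (n : ℕ) (f : A → B) : Prop :=
  ∀ a : Fin (n + 1) → A, crossEffect (n + 1) f a = 0

end PolynomialMaps

namespace PolynomialLaw

open scoped TensorProduct

/-- `F` is homogeneous of degree `n` if `F_S (s • x) = s ^ n • F_S (x)` for every commutative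
`R`-algebra `S`, `s : S` and `x : S ⊗ M`. As in the definition of `PolynomialLaw`, `S` lives in
the universe of `R`; `IsHomogeneousOfDegree.toFun_smul` gives the identity in all universes. -/
def IsHomogeneousOfDegree {R : Type u} [CommSemiring R]
    {M : Type*} [AddCommMonoid M] [Module R M] {N : Type*} [AddCommMonoid N] [Module R N]
    (n : ℕ) (F : PolynomialLaw R M N) : Prop :=
  ∀ (S : Type u) [CommSemiring S] [Algebra R S] (s : S) (x : S ⊗[R] M),
    F.toFun' S (s • x) = s ^ n • F.toFun' S x

/-- `F` has degree `≤ n` if `F = F_0 + F_1 + ⋯ + F_n` with `F_i` homogeneous of degree `i`. -/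
def HasDegreeLE {R : Type u} [CommSemiring R]
    {M : Type*} [AddCommMonoid M] [Module R M] {N : Type*} [AddCommMonoid N] [Module R N]
    (n : ℕ) (F : PolynomialLaw R M N) : Prop :=
  ∃ φ : ℕ → PolynomialLaw R M N,
    (∀ i, (φ i).IsHomogeneousOfDegree i) ∧ F = ∑ i ∈ Finset.range (n + 1), φ i

/-- A polynomial law `F` between commutative algebras is multiplicative if every map
`F_S : S ⊗ A → S ⊗ B` preserves products (it need not preserve `1`). As in the definition of
`PolynomialLaw`, `S` lives in the universe of `R`; `IsMultiplicative.toFun_mul` gives the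
identity in all universes. -/
def IsMultiplicative {R : Type u} [CommSemiring R]
    {A : Type*} [CommSemiring A] [Algebra R A] {B : Type*} [CommSemiring B] [Algebra R B]
    (F : PolynomialLaw R A B) : Prop :=
  ∀ (S : Type u) [CommSemiring S] [Algebra R S] (x y : S ⊗[R] A),
    F.toFun' S (x * y) = F.toFun' S x * F.toFun' S y

theorem rTensor_smul_aux {R : Type*} [CommSemiring R] {M : Type*} [AddCommMonoid M] [Module R M]
    {S T : Type*} [CommSemiring S] [Algebra R S] [CommSemiring T] [Algebra R T]
    (ψ : S →ₐ[R] T) (s : S) (x : S ⊗[R] M) :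
    ψ.toLinearMap.rTensor M (s • x) = ψ s • ψ.toLinearMap.rTensor M x := by
  induction x using TensorProduct.induction_on with
  | zero => simp
  | tmul a m => simp [TensorProduct.smul_tmul']
  | add x y hx hy => simp only [smul_add, map_add, hx, hy]

theorem rTensor_mul_aux {R : Type*} [CommSemiring R] {A : Type*} [CommSemiring A] [Algebra R A]
    {S T : Type*} [CommSemiring S] [Algebra R S] [CommSemiring T] [Algebra R T]
    (ψ : S →ₐ[R] T) (x y : S ⊗[R] A) :
    ψ.toLinearMap.rTensor A (x * y) = ψ.toLinearMap.rTensor A x * ψ.toLinearMap.rTensor A y :=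
  map_mul (Algebra.TensorProduct.map ψ (AlgHom.id R A)) x y

theorem IsHomogeneousOfDegree.toFun_smul {R : Type u} [CommSemiring R]
    {M : Type*} [AddCommMonoid M] [Module R M] {N : Type*} [AddCommMonoid N] [Module R N]
    {n : ℕ} {F : PolynomialLaw R M N} (hF : F.IsHomogeneousOfDegree n)
    (S : Type w) [CommSemiring S] [Algebra R S] (s : S) (x : S ⊗[R] M) :
    F.toFun S (s • x) = s ^ n • F.toFun S x := by
  obtain ⟨k, ψ, p, q, rfl, rfl⟩ := exists_lift' x s
  rw [← rTensor_smul_aux, ← isCompat_apply, ← isCompat_apply, ← toFun'_eq_toFun, hF,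
    rTensor_smul_aux, map_pow]

theorem IsMultiplicative.toFun_mul {R : Type u} [CommSemiring R]
    {A : Type*} [CommSemiring A] [Algebra R A] {B : Type*} [CommSemiring B] [Algebra R B]
    {F : PolynomialLaw R A B} (hF : F.IsMultiplicative)
    (S : Type w) [CommSemiring S] [Algebra R S] (x y : S ⊗[R] A) :
    F.toFun S (x * y) = F.toFun S x * F.toFun S y := by
  obtain ⟨k, ψ, p, rfl⟩ := exists_lift x
  obtain ⟨l, χ, q, rfl⟩ := exists_lift y
  let θ : MvPolynomial (Fin k ⊕ Fin l) R →ₐ[R] S :=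
    MvPolynomial.aeval (Sum.elim (fun i ↦ ψ (MvPolynomial.X i)) fun i ↦ χ (MvPolynomial.X i))
  have h1 : ψ = θ.comp (MvPolynomial.rename Sum.inl) := by ext i; simp [θ]
  have h2 : χ = θ.comp (MvPolynomial.rename Sum.inr) := by ext i; simp [θ]
  rw [h1, h2]
  simp only [AlgHom.comp_toLinearMap, LinearMap.rTensor_comp_apply]
  rw [← rTensor_mul_aux, ← isCompat_apply F θ, ← isCompat_apply F θ, ← isCompat_apply F θ,
    ← toFun'_eq_toFun, hF, rTensor_mul_aux]

end PolynomialLaw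

/-- The multiplicative set of integers not divisible by the prime `p`, so that localising at it
is localising at `p`: `M ↦ M_(p)`. -/
def integersPrimeTo (p : ℕ) [hp : Fact p.Prime] : Submonoid ℤ where
  carrier := {k | ¬ (p : ℤ) ∣ k}
  one_mem' h := (Nat.prime_iff_prime_int.mp hp.out).not_isUnit (isUnit_of_dvd_one h)
  mul_mem' ha hb h := ((Nat.prime_iff_prime_int.mp hp.out).dvd_or_dvd h).elim ha hb

/-! Since `p > n`, the numbers `k!` with `k ≤ n` act invertibly on `B_(p)`; only this is used of the
localisation. Existence is by induction on the degree. The top cross-effect of an `n`-polynomial map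
is symmetric and multilinear, and the diagonal of `cr_n f / n!` has the same `n`-th cross-effect as
`f` (polarisation, `crossEffect_multilinear_diagonal`). Subtracting it lowers the degree, and
diagonals of multilinear maps extend to homogeneous laws (`ofMultilinearMap`). For uniqueness, `s ↦
F (x + s • w)` is a polynomial of degree at most `n` (`HasDegreeLE.tensorCoeff_eq_zero`), hence
determined by its values at natural numbers: the Vandermonde determinant at `0, …, n` is a product
of factorials (`tensorEval_eq_of_natCast`). Replacing integer scalars by arbitrary ones, one pure
tensor at a time (`tensorProduct_induction_of_natCast`), shows that `F` is determined by its
restriction to `A`. The same argument in each factor separately gives multiplicativity. -/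

section MultilinearBaseChange

open scoped TensorProduct

/-! ### Base change of multilinear maps and the polynomial laws they define. -/

namespace MultilinearMap

variable {R : Type*} [CommSemiring R] {M : Type*} [AddCommMonoid M] [Module R M]

instance isScalarTower_of_isScalarTower {ι : Type*} {S : Type*} [CommSemiring S] [Algebra R S]
    {P : ι → Type*} [∀ i, AddCommMonoid (P i)] [∀ i, Module S (P i)]
    {N : Type*} [AddCommMonoid N] [Module R N] [Module S N] [IsScalarTower R S N] :
    IsScalarTower R S (MultilinearMap S P N) :=
  ⟨fun _ _ _ ↦ by ext; simp⟩

/-- The extension of scalars of an `R`-multilinear map on `M` with values in an `S`-module to an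
`S`-multilinear map on `S ⊗[R] M`, as an `R`-linear map. -/
noncomputable def liftBaseChange (S : Type*) [CommSemiring S] [Algebra R S]
    {N : Type*} [AddCommMonoid N] [Module R N] [Module S N] [IsScalarTower R S N] :
    (n : ℕ) → MultilinearMap R (fun _ : Fin n ↦ M) N →ₗ[R]
      MultilinearMap S (fun _ : Fin n ↦ S ⊗[R] M) N
  | 0 =>
    { toFun D := MultilinearMap.constOfIsEmpty S _ (D 0)
      map_add' _ _ := by ext; simp
      map_smul' _ _ := by ext; simp }
  | n + 1 =>
    ((multilinearCurryLeftEquiv S (fun _ : Fin (n + 1) ↦ S ⊗[R] M) N).symm.restrictScalars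
        R).toLinearMap ∘ₗ
      ((LinearMap.liftBaseChangeEquiv S).restrictScalars R).toLinearMap ∘ₗ
      LinearMap.compRight R (liftBaseChange S n) ∘ₗ
      (multilinearCurryLeftEquiv R (fun _ : Fin (n + 1) ↦ M) N).toLinearMap

variable {S : Type*} [CommSemiring S] [Algebra R S]
  {N : Type*} [AddCommMonoid N] [Module R N] [Module S N] [IsScalarTower R S N]

theorem liftBaseChange_zero_apply (D : MultilinearMap R (fun _ : Fin 0 ↦ M) N)
    (x : Fin 0 → S ⊗[R] M) : liftBaseChange S 0 D x = D 0 := rfl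

theorem liftBaseChange_succ_apply {n : ℕ} (D : MultilinearMap R (fun _ : Fin (n + 1) ↦ M) N)
    (x : Fin (n + 1) → S ⊗[R] M) :
    liftBaseChange S (n + 1) D x =
      (liftBaseChange S n ∘ₗ D.curryLeft).liftBaseChange S (x 0) (Fin.tail x) := rfl

theorem liftBaseChange_one_tmul {n : ℕ} (D : MultilinearMap R (fun _ : Fin n ↦ M) N)
    (a : Fin n → M) : liftBaseChange S n D (fun i ↦ 1 ⊗ₜ a i) = D a := by
  induction n with
  | zero => rw [liftBaseChange_zero_apply, Subsingleton.elim 0 a]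
  | succ n ih =>
    rw [liftBaseChange_succ_apply, LinearMap.liftBaseChange_one_tmul, LinearMap.comp_apply]
    refine (ih _ (Fin.tail a)).trans ?_
    rw [curryLeft_apply, Fin.cons_self_tail]

/-- This is the naturality in the scalars that makes `ofMultilinearMap` a polynomial law. -/
theorem liftBaseChange_map {n : ℕ} {T : Type*} [CommSemiring T] [Algebra R T]
    {N' : Type*} [AddCommMonoid N'] [Module R N'] [Module T N'] [IsScalarTower R T N']
    (φ : S →ₐ[R] T) (g : N →ₗ[R] N') (hg : ∀ (s : S) (y : N), g (s • y) = φ s • g y)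
    (D : MultilinearMap R (fun _ : Fin n ↦ M) N) (x : Fin n → S ⊗[R] M) :
    g (liftBaseChange S n D x) =
      liftBaseChange T n (g.compMultilinearMap D)
        (fun i ↦ φ.toLinearMap.rTensor M (x i)) := by
  induction n with
  | zero => rfl
  | succ n ih =>
    rw [liftBaseChange_succ_apply, liftBaseChange_succ_apply]
    generalize x 0 = y
    have ht : (Fin.tail fun i ↦ φ.toLinearMap.rTensor M (x i)) =
      fun i ↦ φ.toLinearMap.rTensor M (Fin.tail x i) := rfl
    rw [ht]
    generalize Fin.tail x = z
    induction y using TensorProduct.induction_on with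
    | zero => simp
    | tmul s a => simp [hg, ih]; rfl
    | add y y' hy hy' => simp only [map_add, add_apply, hy, hy']

end MultilinearMap

namespace PolynomialLaw

variable {R : Type u} [CommSemiring R] {M : Type*} [AddCommMonoid M] [Module R M]
  {N : Type*} [AddCommMonoid N] [Module R N] {n : ℕ}

/-- The polynomial law `x ↦ D (x, …, x)` given by a multilinear map `D`. -/
noncomputable def ofMultilinearMap (D : MultilinearMap R (fun _ : Fin n ↦ M) N) :
    PolynomialLaw R M N where
  toFun' S _ _ x :=
    MultilinearMap.liftBaseChange S n ((TensorProduct.mk R S N 1).compMultilinearMap D) fun _ ↦ x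
  isCompat' {S _ _ T _ _} φ := by
    ext x
    refine (MultilinearMap.liftBaseChange_map φ _ (rTensor_smul_aux φ) _ _).trans ?_
    simp only [Function.comp_apply]
    congr 2
    ext a
    simp

theorem ofMultilinearMap_isHomogeneousOfDegree (D : MultilinearMap R (fun _ : Fin n ↦ M) N) :
    (ofMultilinearMap D).IsHomogeneousOfDegree n := by
  intro S _ _ s x
  refine (MultilinearMap.map_smul_univ _ (fun _ ↦ s) fun _ ↦ x).trans ?_
  rw [Fin.prod_const]
  rfl

theorem ofMultilinearMap_ground (D : MultilinearMap R (fun _ : Fin n ↦ M) N) (a : M) :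
    (ofMultilinearMap D).ground a = D fun _ ↦ a := by
  rw [ground_apply]
  change TensorProduct.lid R N (MultilinearMap.liftBaseChange R n _ fun _ ↦ 1 ⊗ₜ[R] a) = _
  rw [MultilinearMap.liftBaseChange_one_tmul]
  simp

theorem ground_add (F G : PolynomialLaw R M N) : (F + G).ground = F.ground + G.ground :=
  map_add lground F G

theorem IsHomogeneousOfDegree.zero : (0 : PolynomialLaw R M N).IsHomogeneousOfDegree n :=
  fun S _ _ s x ↦ by simp

theorem IsHomogeneousOfDegree.add {F G : PolynomialLaw R M N} (hF : F.IsHomogeneousOfDegree n)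
    (hG : G.IsHomogeneousOfDegree n) : (F + G).IsHomogeneousOfDegree n :=
  fun S _ _ s x ↦ by simp only [add_def_apply, hF S s x, hG S s x, smul_add]

theorem IsHomogeneousOfDegree.hasDegreeLE {F : PolynomialLaw R M N}
    (hF : F.IsHomogeneousOfDegree n) : F.HasDegreeLE n := by
  refine ⟨fun i ↦ if i = n then F else 0, fun i ↦ ?_, by simp⟩
  dsimp only
  split_ifs with h
  · exact h ▸ hF
  · exact .zero

theorem HasDegreeLE.mono {m : ℕ} {F : PolynomialLaw R M N} (hF : F.HasDegreeLE n) (hnm : n ≤ m) :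
    F.HasDegreeLE m := by
  obtain ⟨φ, hφ, rfl⟩ := hF
  refine ⟨fun i ↦ if i < n + 1 then φ i else 0, fun i ↦ ?_, ?_⟩
  · dsimp only
    split_ifs
    · exact hφ i
    · exact .zero
  · rw [← Finset.sum_subset (Finset.range_subset_range.2 (Nat.succ_le_succ hnm))]
    · exact Finset.sum_congr rfl fun i hi ↦ (if_pos (Finset.mem_range.1 hi)).symm
    · exact fun i _ hi ↦ if_neg (mt Finset.mem_range.2 hi)

theorem HasDegreeLE.add {F G : PolynomialLaw R M N} (hF : F.HasDegreeLE n)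
    (hG : G.HasDegreeLE n) : (F + G).HasDegreeLE n := by
  obtain ⟨φ, hφ, rfl⟩ := hF
  obtain ⟨ψ, hψ, rfl⟩ := hG
  exact ⟨φ + ψ, fun i ↦ (hφ i).add (hψ i), Finset.sum_add_distrib.symm⟩

end PolynomialLaw

end MultilinearBaseChange

/-! ### Cross-effects as iterated differences, and polarisation. -/

section CrossEffect

variable {A B C : Type*} [AddCommGroup A] [AddCommGroup B] [AddCommGroup C]

theorem crossEffect_zero (f : A → B) (a : Fin 0 → A) : crossEffect 0 f a = f 0 := by
  rw [crossEffect, Fintype.sum_unique, Finset.sum_eq_zero fun l ↦ l.elim0]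
  simp

/-- Pairing each `U` not containing `0` with `U ∪ {0}` turns the alternating sum into that of a
first difference. -/
theorem crossEffect_cons {n : ℕ} (f : A → B) (a : A) (v : Fin n → A) :
    crossEffect (n + 1) f (Fin.cons a v) = crossEffect n (fun x ↦ f (x + a) - f x) v := by
  classical
  have h0 : (0 : Fin (n + 1)) ∉ Finset.univ.map (Fin.succEmb n) := by simp
  have hu : (Finset.univ : Finset (Finset (Fin (n + 1)))) =
      (insert 0 (Finset.univ.map (Fin.succEmb n))).powerset := by
    rw [← Finset.powerset_univ, Fin.univ_succ, Finset.cons_eq_insert]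
    rfl
  have hp : (Finset.univ.map (Fin.succEmb n)).powerset =
      Finset.univ.map (Finset.mapEmbedding (Fin.succEmb n)).toEmbedding := by
    ext U
    simp [Finset.subset_map_iff, eq_comm]
  rw [crossEffect, hu, Finset.sum_powerset_insert h0, hp, Finset.sum_map, Finset.sum_map,
    ← Finset.sum_add_distrib]
  refine Finset.sum_congr rfl fun U _ ↦ ?_
  have hU : U.card ≤ n := by simpa using U.card_le_univ
  have h0' : (0 : Fin (n + 1)) ∉ U.map (Fin.succEmb n) := by simp
  simp only [RelEmbedding.coe_toEmbedding, Finset.mapEmbedding_apply, Finset.card_map,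
    Finset.card_insert_of_notMem h0', Finset.sum_insert h0', Finset.sum_map, Fin.coe_succEmb,
    Fin.cons_succ, Fin.cons_zero, Nat.add_sub_add_right, Nat.succ_sub hU, pow_succ]
  rw [add_comm a, smul_sub]
  simp only [mul_neg, mul_one, neg_smul]
  abel

theorem crossEffect_add_apply (n : ℕ) (f g : A → B) (a : Fin n → A) :
    crossEffect n (f + g) a = crossEffect n f a + crossEffect n g a := by
  simp [crossEffect, Finset.sum_add_distrib]

theorem crossEffect_sub_apply (n : ℕ) (f g : A → B) (a : Fin n → A) :
    crossEffect n (f - g) a = crossEffect n f a - crossEffect n g a := by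
  simp [crossEffect, smul_sub]

theorem crossEffect_comp_addMonoidHom (n : ℕ) (g : B →+ C) (f : A → B) (a : Fin n → A) :
    crossEffect n (fun x ↦ g (f x)) a = g (crossEffect n f a) := by
  simp [crossEffect]

theorem crossEffect_comp_perm {n : ℕ} (f : A → B) (a : Fin n → A) (σ : Equiv.Perm (Fin n)) :
    crossEffect n f (a ∘ σ) = crossEffect n f a := by
  refine Fintype.sum_equiv (Equiv.finsetCongr σ) _ _ fun U ↦ ?_
  simp

/-- For the difference operators, `Δ_{a+b} = Δ_a Δ_b + Δ_a + Δ_b`. The next cross-effect thus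
measures the failure of additivity. -/
theorem crossEffect_cons_add {n : ℕ} (f : A → B) (a b : A) (v : Fin n → A) :
    crossEffect (n + 1) f (Fin.cons (a + b) v) =
      crossEffect (n + 2) f (Fin.cons a (Fin.cons b v)) +
        (crossEffect (n + 1) f (Fin.cons a v) + crossEffect (n + 1) f (Fin.cons b v)) := by
  simp only [crossEffect_cons]
  rw [← crossEffect_add_apply, ← crossEffect_add_apply]
  congr 1
  ext x
  simp only [Pi.add_apply]
  rw [← add_assoc, add_right_comm x b a]
  abel

theorem IsPolynomialMap.crossEffect_update_add {n : ℕ} {f : A → B} (hf : IsPolynomialMap n f)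
    (v : Fin n → A) (i : Fin n) (a b : A) :
    crossEffect n f (Function.update v i (a + b)) =
      crossEffect n f (Function.update v i a) + crossEffect n f (Function.update v i b) := by
  obtain _ | n := n
  · exact i.elim0
  have h (x : A) : crossEffect (n + 1) f (Function.update v i x) =
      crossEffect (n + 1) f (Fin.cons x (Fin.tail (v ∘ Equiv.swap 0 i))) := by
    rw [← crossEffect_comp_perm f _ (Equiv.swap 0 i), Function.update_comp_equiv]
    congr 1
    rw [Equiv.symm_swap, Equiv.swap_apply_right, ← Fin.cons_self_tail (v ∘ Equiv.swap 0 i),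
      Fin.update_cons_zero]
    rfl
  rw [h, h, h, crossEffect_cons_add, hf, zero_add]

/-- The `n`-th cross-effect of an `n`-polynomial map, as a multilinear map. -/
def IsPolynomialMap.crossEffectMultilinear {n : ℕ} {f : A → B} (hf : IsPolynomialMap n f) :
    MultilinearMap ℤ (fun _ : Fin n ↦ A) B where
  toFun := crossEffect n f
  map_update_add' := by
    intro inst v i a b
    obtain rfl : inst = instDecidableEqFin n := Subsingleton.elim _ _
    exact hf.crossEffect_update_add v i a b
  map_update_smul' := by
    intro inst v i c a
    obtain rfl : inst = instDecidableEqFin n := Subsingleton.elim _ _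
    exact map_zsmul (AddMonoidHom.mk' (fun x ↦ crossEffect n f (Function.update v i x))
      (hf.crossEffect_update_add v i)) c a

/-- Passing to complements gives the alternating sum over the subsets of `Iᶜ`, which vanishes unless
`Iᶜ` is empty. -/
theorem sum_neg_one_pow_card_of_subset {n : ℕ} (I : Finset (Fin n)) :
    ∑ U : Finset (Fin n), (if I ⊆ U then (-1 : ℤ) ^ (n - U.card) else 0) =
      if I = Finset.univ then 1 else 0 := by
  rw [← Equiv.sum_comp (compl_involutive (α := Finset (Fin n))).toPerm]
  have key := Finset.sum_powerset_neg_one_pow_card (x := Iᶜ)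
  simp only [← Finset.compl_eq_empty_iff, ← key, ← Finset.sum_filter]
  refine Finset.sum_congr ?_ fun W _ ↦ ?_
  · ext W
    rw [Finset.mem_powerset, Finset.subset_compl_comm]
    exact Finset.mem_filter_univ W
  · have hW : W.card ≤ n := by simpa using W.card_le_univ
    simp [Finset.card_compl, Nat.sub_sub_self hW]

/-- Expanding multilinearly gives terms `D (v ∘ r)` for self-maps `r` of `Fin n`. The signs cancel
those with `r` not surjective; the rest are the `n!` permutations, each contributing `D v` by
symmetry. -/
theorem crossEffect_multilinear_diagonal {n : ℕ} (D : MultilinearMap ℤ (fun _ : Fin n ↦ A) B)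
    (hD : ∀ (v : Fin n → A) (σ : Equiv.Perm (Fin n)), D (v ∘ σ) = D v) (v : Fin n → A) :
    crossEffect n (fun x ↦ D fun _ ↦ x) v = n.factorial • D v := by
  classical
  have h (U : Finset (Fin n)) : (D fun _ ↦ ∑ l ∈ U, v l) =
      ∑ r : Fin n → Fin n, if Finset.univ.image r ⊆ U then D (v ∘ r) else 0 := by
    rw [D.map_sum_finset (fun _ j ↦ v j) (fun _ ↦ U), ← Finset.sum_filter]
    refine Finset.sum_congr ?_ fun _ _ ↦ rfl
    ext r
    simp [Fintype.mem_piFinset, Finset.image_subset_iff]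
  simp only [crossEffect, h, Finset.smul_sum]
  rw [Finset.sum_comm]
  have h2 (r : Fin n → Fin n) :
      ∑ U : Finset (Fin n), (-1 : ℤ) ^ (n - U.card) •
        (if Finset.univ.image r ⊆ U then D (v ∘ r) else 0) =
      if Function.Bijective r then D v else 0 := by
    have h3 : Finset.univ.image r = Finset.univ ↔ Function.Bijective r := by
      rw [← Finite.injective_iff_bijective, Finite.injective_iff_surjective,
        ← Set.range_eq_univ, ← Finset.coe_eq_univ, Finset.coe_image, Finset.coe_univ,
        Set.image_univ]
    simp only [← h3, smul_ite, smul_zero]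
    have h4 := congrArg (· • D (v ∘ r)) (sum_neg_one_pow_card_of_subset (Finset.univ.image r))
    simp only [Finset.sum_smul, ite_smul, zero_smul, one_smul] at h4
    rw [h4]
    split_ifs with h5
    · exact hD v (Equiv.ofBijective r (h3.1 h5))
    · rfl
  simp only [h2]
  rw [← Finset.sum_filter, Finset.sum_const]
  congr 1
  have h4 : Finset.univ.filter (fun r : Fin n → Fin n ↦ Function.Bijective r) =
      Finset.univ.image fun σ : Equiv.Perm (Fin n) ↦ (σ : Fin n → Fin n) := by
    ext r
    simp only [Finset.mem_filter, Finset.mem_univ, true_and, Finset.mem_image]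
    exact ⟨fun hr ↦ ⟨Equiv.ofBijective r hr, rfl⟩, by rintro ⟨σ, rfl⟩; exact σ.bijective⟩
  rw [h4, Finset.card_image_of_injective _ DFunLike.coe_injective, Finset.card_univ,
    Fintype.card_perm, Fintype.card_fin]

end CrossEffect

/-! ### Existence of the extension. -/

section Existence

variable {A C : Type*} [AddCommGroup A] [AddCommGroup C]

/-- If `n!` and the smaller factorials are invertible on `C`, every `n`-polynomial map to `C`
extends to a polynomial law of degree `≤ n`. -/
theorem IsPolynomialMap.exists_polynomialLaw {n : ℕ}
    (hC : ∀ k ≤ n, IsUnit (k.factorial : Module.End ℤ C)) {f : A → C}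
    (hf : IsPolynomialMap n f) :
    ∃ F : PolynomialLaw ℤ A C, F.HasDegreeLE n ∧ F.ground = f := by
  induction n generalizing f with
  | zero =>
    refine ⟨.ofMultilinearMap (MultilinearMap.constOfIsEmpty ℤ (fun _ : Fin 0 ↦ A) (f 0)),
      (PolynomialLaw.ofMultilinearMap_isHomogeneousOfDegree _).hasDegreeLE, ?_⟩
    ext a
    have h := hf (Fin.cons a Fin.elim0)
    rw [crossEffect_cons, crossEffect_zero, zero_add, sub_eq_zero] at h
    rw [PolynomialLaw.ofMultilinearMap_ground, h]
    rfl
  | succ n ih =>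
    -- `e` is division by `(n + 1)!`.
    obtain ⟨e, he⟩ := (hC (n + 1) le_rfl).exists_right_inv
    have he' (c : C) : (n + 1).factorial • e c = c := by
      simpa using LinearMap.congr_fun he c
    let D := e.compMultilinearMap hf.crossEffectMultilinear
    have hD (v : Fin (n + 1) → A) : D v = e (crossEffect (n + 1) f v) := rfl
    have hg : IsPolynomialMap n (f - fun a ↦ D fun _ ↦ a) := fun v ↦ by
      rw [crossEffect_sub_apply, crossEffect_multilinear_diagonal, hD, he', sub_self]
      exact fun v σ ↦ by rw [hD, crossEffect_comp_perm, hD]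
    obtain ⟨F, hF, hFg⟩ := ih (fun k hk ↦ hC k (hk.trans n.le_succ)) hg
    refine ⟨F + .ofMultilinearMap D, (hF.mono n.le_succ).add
      (PolynomialLaw.ofMultilinearMap_isHomogeneousOfDegree D).hasDegreeLE, ?_⟩
    ext a
    rw [PolynomialLaw.ground_add, hFg, Pi.add_apply, PolynomialLaw.ofMultilinearMap_ground]
    simp

end Existence

/-! ### Restriction of a polynomial law to a line `x + X • w`, and its degree. -/

section Degree

open scoped TensorProduct
open Polynomial

namespace PolynomialLaw

variable {R : Type u} [CommSemiring R] {S : Type u} [CommSemiring S] [Algebra R S]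
  {M : Type*} [AddCommMonoid M] [Module R M] {N : Type*} [AddCommMonoid N] [Module R N]

variable (R N) in
/-- The `j`-th coefficient of a polynomial over `S` with coefficients in `S ⊗[R] N`. -/
noncomputable def tensorCoeff (j : ℕ) : S[X] ⊗[R] N →ₗ[R] S ⊗[R] N :=
  ((lcoeff S j).restrictScalars R).rTensor N

variable (R N) in
/-- The value at `s` of a polynomial over `S` with coefficients in `S ⊗[R] N`. -/
noncomputable def tensorEval (s : S) : S[X] ⊗[R] N →ₗ[R] S ⊗[R] N :=
  ((aeval s : S[X] →ₐ[S] S).restrictScalars R).toLinearMap.rTensor N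

variable (R N S) in
/-- Constant polynomials with coefficients in `S ⊗[R] N`. -/
noncomputable def tensorC : S ⊗[R] N →ₗ[R] S[X] ⊗[R] N :=
  (CAlgHom : S →ₐ[R] S[X]).toLinearMap.rTensor N

theorem exists_tensorEval_eq_sum (z : S[X] ⊗[R] N) :
    ∃ m, ∀ m' ≥ m, ∀ s, tensorEval R N s z =
      ∑ j ∈ Finset.range m', s ^ j • tensorCoeff R N j z := by
  induction z using TensorProduct.induction_on with
  | zero => exact ⟨0, by simp⟩
  | tmul p y =>
    refine ⟨p.natDegree + 1, fun m' hm s ↦ ?_⟩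
    simp [tensorEval, tensorCoeff, aeval_eq_sum_range' (Nat.lt_of_succ_le hm),
      TensorProduct.smul_tmul', TensorProduct.sum_tmul, mul_comm]
  | add z z' hz hz' =>
    obtain ⟨m, hm⟩ := hz
    obtain ⟨m', hm'⟩ := hz'
    refine ⟨max m m', fun k hk s ↦ ?_⟩
    simp only [map_add, smul_add, Finset.sum_add_distrib,
      hm k ((le_max_left _ _).trans hk), hm' k ((le_max_right _ _).trans hk)]

theorem tensorEval_eq_sum {n : ℕ} {z : S[X] ⊗[R] N} (hz : ∀ j > n, tensorCoeff R N j z = 0)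
    (s : S) :
    tensorEval R N s z = ∑ j ∈ Finset.range (n + 1), s ^ j • tensorCoeff R N j z := by
  obtain ⟨m, hm⟩ := exists_tensorEval_eq_sum z
  rw [hm (max m (n + 1)) (le_max_left _ _)]
  refine (Finset.sum_subset (Finset.range_subset_range.2 (le_max_right _ _)) fun j _ hj ↦ ?_).symm
  rw [hz j (Nat.lt_of_succ_le (not_lt.1 (mt Finset.mem_range.2 hj))), smul_zero]

theorem tensorEval_tensorC (s : S) (x : S ⊗[R] N) : tensorEval R N s (tensorC R S N x) = x := by
  induction x using TensorProduct.induction_on with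
  | zero => simp
  | tmul a y => simp [tensorEval, tensorC]
  | add x y hx hy => simp only [map_add, hx, hy]

variable (F : PolynomialLaw R M N)

theorem tensorEval_toFun' (s : S) (x w : S ⊗[R] M) :
    tensorEval R N s (F.toFun' S[X] (tensorC R S M x + (X : S[X]) • tensorC R S M w)) =
      F.toFun' S (x + s • w) := by
  rw [tensorEval, isCompat_apply', map_add, rTensor_smul_aux]
  have h := tensorEval_tensorC (R := R) (N := M) s
  rw [tensorEval] at h
  rw [h, h]
  simp

open LaurentPolynomial in
-- Over Laurent polynomials `x + T • w = T • (T⁻¹ • x + w)`, so by homogeneity the value is `T ^ i`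
-- times an expression in `T⁻¹` alone and has no exponent above `i`.
theorem IsHomogeneousOfDegree.tensorCoeff_eq_zero {F : PolynomialLaw R M N} {i : ℕ}
    (hF : F.IsHomogeneousOfDegree i) (x w : S ⊗[R] M) (j : ℕ) (hj : i < j) :
    tensorCoeff R N j
      (F.toFun' S[X] (tensorC R S M x + (X : S[X]) • tensorC R S M w)) = 0 := by
  -- `ι` sends `X` to `T` and `τ` sends `X` to `T⁻¹`; `lc m` reads off the coefficient of `T ^ m`.
  let ι : S[X] →ₐ[R] S[T;T⁻¹] := (toLaurentAlg : S[X] →ₐ[S] S[T;T⁻¹]).restrictScalars R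
  let τ : S[X] →ₐ[R] S[T;T⁻¹] := (aeval (T (-1)) : S[X] →ₐ[S] S[T;T⁻¹]).restrictScalars R
  let lc (m : ℤ) : S[T;T⁻¹] →ₗ[R] S :=
    { toFun f := f.coeff m
      map_add' _ _ := rfl
      map_smul' _ _ := rfl }
  have hι (y : S ⊗[R] M) : ι.toLinearMap.rTensor M (tensorC R S M y) =
      τ.toLinearMap.rTensor M (tensorC R S M y) := by
    rw [tensorC, ← LinearMap.rTensor_comp_apply, ← LinearMap.rTensor_comp_apply]
    congr 2
    refine LinearMap.ext fun a ↦ ?_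
    exact (toLaurent_C a).trans (aeval_C _ a).symm
  have h1 : ι.toLinearMap.rTensor M (tensorC R S M x + (X : S[X]) • tensorC R S M w) =
      (T 1 : S[T;T⁻¹]) •
        τ.toLinearMap.rTensor M ((X : S[X]) • tensorC R S M x + tensorC R S M w) := by
    rw [map_add, map_add, rTensor_smul_aux, rTensor_smul_aux, hι, hι, smul_add, smul_smul]
    have hιX : ι X = T 1 := toLaurent_X
    have hτX : τ X = T (-1) := aeval_X _
    rw [hιX, hτX, ← T_add, add_neg_cancel, T_zero, _root_.one_smul]
  have h2 (p : S[X] ⊗[R] N) : tensorCoeff R N j p =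
      (lc j).rTensor N (ι.toLinearMap.rTensor N p) := by
    rw [tensorCoeff, ← LinearMap.rTensor_comp_apply]
    congr 2
    ext p
    change p.coeff j = (toLaurent p).coeff j
    rw [coeff_toLaurent]
    exact (Finsupp.mapDomain_apply Nat.cast_injective _ j).symm
  have h4 (p : S[X]) : lc j ((T 1 : S[T;T⁻¹]) ^ i * τ p) = 0 := by
    induction p using Polynomial.induction_on' with
    | add p q hp hq => rw [map_add, mul_add, map_add, hp, hq, add_zero]
    | monomial k a =>
      have : (T 1 : S[T;T⁻¹]) ^ i * τ (monomial k a) = .single (i - k : ℤ) a := by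
        simp only [τ, AlgHom.restrictScalars_apply, aeval_monomial, T_pow,
          ← LaurentPolynomial.C_eq_algebraMap, LaurentPolynomial.single_eq_C_mul_T]
        rw [mul_left_comm, ← T_add]
        congr 2
        ring
      rw [this]
      exact Finsupp.single_eq_of_ne (by lia)
  have h3 (p : S[X] ⊗[R] N) :
      (lc j).rTensor N ((T 1 : S[T;T⁻¹]) ^ i • τ.toLinearMap.rTensor N p) = 0 := by
    induction p using TensorProduct.induction_on with
    | zero => simp
    | add p q hp hq => simp only [map_add, smul_add, hp, hq, add_zero]
    | tmul p y =>
      simp only [LinearMap.rTensor_tmul, TensorProduct.smul_tmul', smul_eq_mul,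
        AlgHom.toLinearMap_apply]
      rw [h4, TensorProduct.zero_tmul]
  rw [h2, isCompat_apply', h1, hF, ← isCompat_apply', h3]

end PolynomialLaw
end Degree

/-! ### Interpolation at natural numbers and uniqueness. -/

section Uniqueness

open scoped TensorProduct
open Polynomial

/-- Multiplying the system for `k = 0, …, n` by the adjugate of its Vandermonde matrix isolates each
coefficient, scaled by the determinant `n.superFactorial`. -/
theorem eq_of_sum_pow_smul_eq {P : Type*} [AddCommMonoid P] [Module ℤ P] {n : ℕ}
    (hP : ∀ x y : P, (n.superFactorial : ℤ) • x = (n.superFactorial : ℤ) • y → x = y)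
    {c d : ℕ → P} (h : ∀ k : ℕ, ∑ j ∈ Finset.range (n + 1), (k : ℤ) ^ j • c j =
      ∑ j ∈ Finset.range (n + 1), (k : ℤ) ^ j • d j) {j : ℕ} (hj : j < n + 1) : c j = d j := by
  let V : Matrix (Fin (n + 1)) (Fin (n + 1)) ℤ := .vandermonde fun i ↦ (i : ℤ)
  have key (c : ℕ → P) : ∑ k : Fin (n + 1), V.adjugate ⟨j, hj⟩ k •
      ∑ l ∈ Finset.range (n + 1), ((k : ℕ) : ℤ) ^ l • c l = (n.superFactorial : ℤ) • c j := by
    simp only [Finset.sum_range, Finset.smul_sum, smul_smul]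
    rw [Finset.sum_comm]
    simp only [← Finset.sum_smul]
    have hV (l : Fin (n + 1)) : ∑ k : Fin (n + 1), V.adjugate ⟨j, hj⟩ k * (k : ℤ) ^ (l : ℕ) =
        if ⟨j, hj⟩ = l then (n.superFactorial : ℤ) else 0 := by
      have := congrFun (congrFun V.adjugate_mul ⟨j, hj⟩) l
      rw [Matrix.det_vandermonde_id_eq_superFactorial, Matrix.mul_apply] at this
      simpa [V, Matrix.one_apply] using this
    simp [hV]
  apply hP
  rw [← key c, ← key d]
  simp only [h]

namespace PolynomialLaw

variable {A C : Type*} [AddCommGroup A] [AddCommGroup C]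

theorem tensorProduct_smul_injective {m : ℕ} (hm : IsUnit (m : Module.End ℤ C))
    {S : Type*} [CommSemiring S] [Algebra ℤ S] (x y : S ⊗[ℤ] C)
    (h : (m : ℤ) • x = (m : ℤ) • y) : x = y := by
  obtain ⟨e, he⟩ := hm.exists_right_inv
  have key (z : S ⊗[ℤ] C) : e.lTensor S ((m : ℤ) • z) = z := by
    rw [map_smul]
    induction z using TensorProduct.induction_on with
    | zero => simp
    | tmul s c =>
      rw [LinearMap.lTensor_tmul, ← TensorProduct.tmul_smul]
      congr 1
      simpa using LinearMap.congr_fun he c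
    | add z z' hz hz' => rw [map_add, smul_add, hz, hz']
  rw [← key x, h, key]

theorem isUnit_superFactorial {n : ℕ} (hC : ∀ k ≤ n, IsUnit (k.factorial : Module.End ℤ C)) :
    IsUnit (n.superFactorial : Module.End ℤ C) := by
  induction n with
  | zero => simp
  | succ n ih =>
    rw [Nat.superFactorial, Nat.cast_mul]
    exact (hC _ le_rfl).mul (ih fun k hk ↦ hC k (hk.trans n.le_succ))

/-- Two polynomials of degree `≤ n` with coefficients in `S ⊗ C` coincide as soon as their values at
integers coincide. -/
theorem tensorEval_eq_of_natCast {n : ℕ} (hC : ∀ k ≤ n, IsUnit (k.factorial : Module.End ℤ C))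
    {S : Type} [CommSemiring S] [Algebra ℤ S] {z z' : S[X] ⊗[ℤ] C}
    (hz : ∀ j > n, tensorCoeff ℤ C j z = 0) (hz' : ∀ j > n, tensorCoeff ℤ C j z' = 0)
    (h : ∀ k : ℕ, tensorEval ℤ C (k : S) z = tensorEval ℤ C (k : S) z') (s : S) :
    tensorEval ℤ C s z = tensorEval ℤ C s z' := by
  rw [tensorEval_eq_sum hz, tensorEval_eq_sum hz']
  refine Finset.sum_congr rfl fun j hj ↦ congrArg (s ^ j • ·) ?_
  refine eq_of_sum_pow_smul_eq (tensorProduct_smul_injective (isUnit_superFactorial hC))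
    (c := fun j ↦ tensorCoeff ℤ C j z) (d := fun j ↦ tensorCoeff ℤ C j z') (fun k ↦ ?_)
    (Finset.mem_range.1 hj)
  have := h k
  rw [tensorEval_eq_sum hz, tensorEval_eq_sum hz'] at this
  have hs (x : S ⊗[ℤ] C) (j : ℕ) : (k : ℤ) ^ j • x = (k : S) ^ j • x := by
    rw [← algebraMap_smul S ((k : ℤ) ^ j) x]
    simp
  simpa only [hs] using this

theorem HasDegreeLE.tensorCoeff_eq_zero {R : Type u} [CommSemiring R] {S : Type u}
    [CommSemiring S] [Algebra R S] {M : Type*} [AddCommMonoid M] [Module R M]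
    {N : Type*} [AddCommMonoid N] [Module R N] {F : PolynomialLaw R M N} {n : ℕ}
    (hF : F.HasDegreeLE n) (x w : S ⊗[R] M) (j : ℕ) (hj : n < j) :
    tensorCoeff R N j
      (F.toFun' S[X] (tensorC R S M x + (X : S[X]) • tensorC R S M w)) = 0 := by
  obtain ⟨φ, hφ, rfl⟩ := hF
  have h (t : Finset ℕ) (y : S[X] ⊗[R] M) :
      (∑ i ∈ t, φ i).toFun' S[X] y = ∑ i ∈ t, (φ i).toFun' S[X] y := by
    induction t using Finset.cons_induction with
    | empty => simp
    | cons a t ha ih => rw [Finset.sum_cons, Finset.sum_cons, add_def_apply, ih]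
  rw [h, map_sum]
  exact Finset.sum_eq_zero fun i hi ↦ (hφ i).tensorCoeff_eq_zero x w j
    ((Finset.mem_range_succ_iff.1 hi).trans_lt hj)

/-- A property of elements of `S ⊗ A` that holds on the image of `A` holds everywhere if its
validity at `x + k ⊗ a` for all integers `k` implies its validity at `x + s ⊗ a` for all `s`. -/
theorem tensorProduct_induction_of_natCast {S : Type*} [CommSemiring S] [Algebra ℤ S]
    {P : S ⊗[ℤ] A → Prop} (h1 : ∀ a : A, P (1 ⊗ₜ a))
    (h2 : ∀ x w, (∀ k : ℕ, P (x + (k : S) • w)) → ∀ s : S, P (x + s • w)) (x : S ⊗[ℤ] A) :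
    P x := by
  -- The translate by an arbitrary `1 ⊗ₜ b` is what lets the induction run: at integer scalars, `k ⊗
  -- a = 1 ⊗ (k • a)` is absorbed into it.
  suffices ∀ y : S ⊗[ℤ] A, (∀ b : A, P (y + 1 ⊗ₜ b)) → ∀ b : A, P (y + x + 1 ⊗ₜ b) by
    simpa using this 0 (by simpa using h1) 0
  induction x using TensorProduct.induction_on with
  | zero => simp
  | add x x' hx hx' =>
    intro y hy b
    rw [← add_assoc]
    exact hx' _ (hx _ hy) b
  | tmul s a =>
    intro y hy b
    have := h2 (y + 1 ⊗ₜ b) (1 ⊗ₜ a) (fun k ↦ ?_) s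
    · rw [TensorProduct.smul_tmul', smul_eq_mul, mul_one] at this
      rwa [add_right_comm]
    · have hk : (k : S) • (1 ⊗ₜ[ℤ] a : S ⊗[ℤ] A) = 1 ⊗ₜ (k • a) := by
        rw [TensorProduct.tmul_smul, Nat.cast_smul_eq_nsmul]
      rw [hk, add_assoc, ← TensorProduct.tmul_add]
      exact hy _

theorem HasDegreeLE.eq_of_ground_eq {n : ℕ}
    (hC : ∀ k ≤ n, IsUnit (k.factorial : Module.End ℤ C)) {F G : PolynomialLaw ℤ A C}
    (hF : F.HasDegreeLE n) (hG : G.HasDegreeLE n) (h : ∀ a, F.ground a = G.ground a) : F = G := by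
  ext S _ _ x
  refine tensorProduct_induction_of_natCast (P := fun x ↦ F.toFun' S x = G.toFun' S x)
    (fun a ↦ ?_) (fun x w hxw s ↦ ?_) x
  · rw [← one_tmul_ground_apply', ← one_tmul_ground_apply', h]
  · rw [← tensorEval_toFun' F, ← tensorEval_toFun' G]
    refine tensorEval_eq_of_natCast hC (hF.tensorCoeff_eq_zero x w) (hG.tensorCoeff_eq_zero x w)
      (fun k ↦ ?_) s
    rw [tensorEval_toFun', tensorEval_toFun']
    exact hxw k

end PolynomialLaw
end Uniqueness

/-! ### Multiplicativity. -/

section Multiplicative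

open scoped TensorProduct
open Polynomial

namespace PolynomialLaw

section

variable {R : Type u} [CommSemiring R] {S : Type u} [CommSemiring S] [Algebra R S]
  {N : Type*} [CommSemiring N] [Algebra R N]

theorem tensorCoeff_mul_tensorC (j : ℕ) (z : S[X] ⊗[R] N) (y : S ⊗[R] N) :
    tensorCoeff R N j (z * tensorC R S N y) = tensorCoeff R N j z * y := by
  induction z using TensorProduct.induction_on with
  | zero => simp
  | add z z' hz hz' => simp only [add_mul, map_add, hz, hz']
  | tmul p b =>
    induction y using TensorProduct.induction_on with
    | zero => simp
    | add y y' hy hy' => simp only [mul_add, map_add, hy, hy']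
    | tmul s c => simp [tensorCoeff, tensorC]

theorem tensorEval_mul_tensorC (s : S) (z : S[X] ⊗[R] N) (y : S ⊗[R] N) :
    tensorEval R N s (z * tensorC R S N y) = tensorEval R N s z * y := by
  conv_rhs => rw [← tensorEval_tensorC (R := R) s y]
  exact rTensor_mul_aux _ _ _

end

variable {A C : Type*} [CommRing A] [CommRing C]

/-- With `y` fixed, both sides are polynomials in `s` of degree at most `n`: the left one is `F` on
the line `x * y + s • (w * y)`, the right one has its coefficients multiplied by the constant `F y`.
-/
theorem HasDegreeLE.toFun'_mul_eq_of_natCast {n : ℕ}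
    (hC : ∀ k ≤ n, IsUnit (k.factorial : Module.End ℤ C)) {F : PolynomialLaw ℤ A C}
    (hF : F.HasDegreeLE n) {S : Type} [CommSemiring S] [Algebra ℤ S] {x w y : S ⊗[ℤ] A}
    (h : ∀ k : ℕ, F.toFun' S ((x + (k : S) • w) * y) =
      F.toFun' S (x + (k : S) • w) * F.toFun' S y) (s : S) :
    F.toFun' S ((x + s • w) * y) = F.toFun' S (x + s • w) * F.toFun' S y := by
  have h1 (s : S) : (x + s • w) * y = x * y + s • (w * y) := by rw [add_mul, smul_mul_assoc]
  rw [h1, ← tensorEval_toFun' F s, ← tensorEval_toFun' F s, ← tensorEval_mul_tensorC]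
  refine tensorEval_eq_of_natCast hC (hF.tensorCoeff_eq_zero _ _) (fun j hj ↦ ?_) (fun k ↦ ?_) s
  · rw [tensorCoeff_mul_tensorC, hF.tensorCoeff_eq_zero _ _ j hj, zero_mul]
  · rw [tensorEval_mul_tensorC, tensorEval_toFun', tensorEval_toFun', ← h1]
    exact h k

theorem HasDegreeLE.isMultiplicative {n : ℕ}
    (hC : ∀ k ≤ n, IsUnit (k.factorial : Module.End ℤ C)) {F : PolynomialLaw ℤ A C}
    (hF : F.HasDegreeLE n) (h : ∀ a b, F.ground (a * b) = F.ground a * F.ground b) :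
    F.IsMultiplicative := by
  intro S _ _ x y
  refine tensorProduct_induction_of_natCast
    (P := fun x ↦ F.toFun' S (x * y) = F.toFun' S x * F.toFun' S y)
    (fun a ↦ ?_) (fun x w ↦ hF.toFun'_mul_eq_of_natCast hC) x
  refine tensorProduct_induction_of_natCast
    (P := fun y ↦ F.toFun' S (1 ⊗ₜ a * y) = F.toFun' S (1 ⊗ₜ a) * F.toFun' S y)
    (fun b ↦ ?_) (fun y w hyw s ↦ ?_) y
  · rw [Algebra.TensorProduct.tmul_mul_tmul, mul_one, ← one_tmul_ground_apply',
      ← one_tmul_ground_apply', ← one_tmul_ground_apply', h,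
      Algebra.TensorProduct.tmul_mul_tmul, mul_one]
  · rw [mul_comm, mul_comm (F.toFun' S _)]
    refine hF.toFun'_mul_eq_of_natCast hC (fun k ↦ ?_) s
    rw [mul_comm, mul_comm (F.toFun' S _)]
    exact hyw k

end PolynomialLaw
end Multiplicative

/-! ### Localisation at `p` and the main theorem. -/

theorem natCast_factorial_mem_integersPrimeTo {n p : ℕ} [hp : Fact p.Prime] (hnp : n < p) :
    ((n.factorial : ℕ) : ℤ) ∈ integersPrimeTo p := fun h ↦
  hnp.not_ge ((Nat.Prime.dvd_factorial hp.out).1 (Int.natCast_dvd_natCast.1 h))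

theorem isUnit_factorial_of_isLocalizedModule {n p : ℕ} [Fact p.Prime] (hnp : n < p)
    {B C : Type*} [AddCommGroup B] [AddCommGroup C] (loc : B →ₗ[ℤ] C)
    [IsLocalizedModule (integersPrimeTo p) loc] (k : ℕ) (hk : k ≤ n) :
    IsUnit (k.factorial : Module.End ℤ C) := by
  have := IsLocalizedModule.map_units loc
    ⟨_, natCast_factorial_mem_integersPrimeTo (hk.trans_lt hnp)⟩
  simpa using this

theorem IsPolynomialMap.comp_addMonoidHom {n : ℕ} {A B C : Type*} [AddCommGroup A]
    [AddCommGroup B] [AddCommGroup C] {f : A → B} (hf : IsPolynomialMap n f) (g : B →+ C) :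
    IsPolynomialMap n fun a ↦ g (f a) :=
  fun v ↦ by rw [crossEffect_comp_addMonoidHom, hf, map_zero]

theorem mainTheorem4 (n p : ℕ) [Fact p.Prime] (hnp : n < p) :
    (∀ (A : Type u) (B : Type v) (Bp : Type w)
        [AddCommGroup A] [AddCommGroup B] [AddCommGroup Bp]
        (loc : B →ₗ[ℤ] Bp) [IsLocalizedModule (integersPrimeTo p) loc]
        (f : A → B), IsPolynomialMap n f →
      ∃! F : PolynomialLaw ℤ A Bp, F.HasDegreeLE n ∧ ∀ a, F.ground a = loc (f a)) ∧
    (∀ (A : Type u) (B : Type v) (Bp : Type w)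
        [CommRing A] [CommRing B] [CommRing Bp] [Algebra B Bp]
        [IsLocalization (Algebra.algebraMapSubmonoid B (integersPrimeTo p)) Bp]
        (f : A → B), IsPolynomialMap n f → (∀ a a', f (a * a') = f a * f a') →
      ∃ F : PolynomialLaw ℤ A Bp,
        (F.HasDegreeLE n ∧ ∀ a, F.ground a = algebraMap B Bp (f a)) ∧
        (∀ G : PolynomialLaw ℤ A Bp,
          (G.HasDegreeLE n ∧ ∀ a, G.ground a = algebraMap B Bp (f a)) → G = F) ∧
        F.IsMultiplicative) := by
  have key (A : Type u) (B : Type v) (Bp : Type w)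
      [AddCommGroup A] [AddCommGroup B] [AddCommGroup Bp]
      (loc : B →ₗ[ℤ] Bp) [IsLocalizedModule (integersPrimeTo p) loc]
      (f : A → B) (hf : IsPolynomialMap n f) :
      ∃! F : PolynomialLaw ℤ A Bp, F.HasDegreeLE n ∧ ∀ a, F.ground a = loc (f a) := by
    have hC := isUnit_factorial_of_isLocalizedModule hnp loc
    obtain ⟨F, hF, hFf⟩ := (hf.comp_addMonoidHom loc.toAddMonoidHom).exists_polynomialLaw hC
    exact ⟨F, ⟨hF, congrFun hFf⟩, fun G hG ↦ hG.1.eq_of_ground_eq hC hF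
      fun a ↦ (hG.2 a).trans (congrFun hFf a).symm⟩
  refine ⟨key, fun A B Bp _ _ _ _ _ f hf hmul ↦ ?_⟩
  -- The ring localisation of `B` is also its localisation as a `ℤ`-module, so the additive
  -- statement applies.
  have hloc : IsLocalizedModule (integersPrimeTo p) (IsScalarTower.toAlgHom ℤ B Bp).toLinearMap :=
    isLocalizedModule_iff_isLocalization.2 inferInstance
  obtain ⟨F, ⟨hF, hFf⟩, hu⟩ := key A B Bp (IsScalarTower.toAlgHom ℤ B Bp).toLinearMap f hf
  refine ⟨F, ⟨hF, hFf⟩, hu, hF.isMultiplicative (isUnit_factorial_of_isLocalizedModule hnp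
    (IsScalarTower.toAlgHom ℤ B Bp).toLinearMap) fun a b ↦ ?_⟩
  rw [hFf, hFf, hFf, hmul]
  exact map_mul (algebraMap B Bp) _ _
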